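/- **Conventions.** An inverse sequence of groups $\{G_i,\lambda_i\}$ is a sequence $G_0 \xleftarrow{\lambda_1} G_1 \xleftarrow{\lambda_2} G_2 \leftarrow \cdots$ of groups and homomorphisms. Two inverse sequences $\{G_i,\lambda_i\}$ and $\{H_j,\mu_j\}$ are *pro-isomorphic* if, after passing to subsequences, there is a commuting ladder $G_{i_0} \leftarrow H_{j_0} \leftarrow G_{i_1} \leftarrow H_{j_1} \leftarrow \cdots$ whose two-step composites are the composites of bonding maps of the two sequences. An inverse sequence is *stable* if it is pro-isomorphic to a constant sequence $\{H,\mathrm{id}_H\}$, and *pro-monomorphic* if it is pro-isomorphic to a sequence all of whose bonding maps are injective. A space $X$ is *one-ended* if there is a compact $C\subseteq X$ such that for every compact $D\supseteq C$ exactly one component of $X-D$ has noncompact closure. A *neighborhood of infinity* is a set $N\subseteq X$ with $\overline{X-N}$ compact. Given connected neighborhoods of infinity $N_0\supseteq N_1\supseteq\cdots$ with $N_{i+1}\subseteq \operatorname{int} N_i$ such that each compact subset of $X$ is disjoint from some $N_i$, base points $p_i\in N_i$, and paths $r_i$ in $N_i$ from $p_i$ to $p_{i+1}$, one obtains an inverse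 sequence $$\pi_1(N_0,p_0)\leftarrow \pi_1(N_1,p_1)\leftarrow \pi_1(N_2,p_2)\leftarrow\cdots$$ in which each map is induced by inclusion followed by the change of base point along $r_i$; it represents $\operatorname{pro}\text{-}\pi_1(X,r)$, where the base ray $r$ is the concatenation of the $r_i$. We say that $X$ *has pro-monomorphic fundamental group at infinity* if such a sequence is pro-monomorphic for some choice of these data (for one-ended $X$ as below the choice is immaterial), and that $X$ *has stable fundamental group at infinity* if such data exist and for every choice of them the resulting sequence is stable. The group $\mathbb Z$ *acts by covering transformations* on $X$ if it acts by homeomorphisms, freely and properly discontinuously (for each compact $K\subseteq X$ only finitely many $n\in\mathbb Z$ satisfy $nK\cap K\neq\varnothing$). **Proposition.** Let $X$ be a one-ended, simply connected, locally compact, locally path connected, separable metric space with pro-monomorphic fundamental group at infinity. If $\mathbb{Z}$ acts by covering transformations on $X$, then $X$ has stable fundamental group at infinity. -/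

import Mathlib

universe u v

/-! ### Inverse sequences of groups -/

/-- An inverse sequence of groups `G₀ ← G₁ ← G₂ ← ⋯`. -/
structure InverseSequence where
  /-- The groups of the sequence. -/
  obj : ℕ → Type u
  [group : ∀ n, Group (obj n)]
  /-- The bonding homomorphisms. -/
  bond : ∀ n, obj (n + 1) →* obj n

attribute [instance] InverseSequence.group

namespace InverseSequence

/-- The composite `G_n → G_{n-1} → ⋯ → G_m` of bonding homomorphisms, for `m ≤ n`. -/
def comp (G : InverseSequence.{u}) {m n : ℕ} (h : m ≤ n) : G.obj n →* G.obj m :=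
  Nat.leRec (motive := fun n _ => G.obj n →* G.obj m) (MonoidHom.id _)
    (fun k _ f => f.comp (G.bond k)) h

theorem comp_self (G : InverseSequence.{u}) (m : ℕ) :
    G.comp (le_refl m) = MonoidHom.id _ :=
  Nat.leRec_self _ _

theorem comp_succ (G : InverseSequence.{u}) {m n : ℕ} (h : m ≤ n) :
    G.comp (h.trans n.le_succ) = (G.comp h).comp (G.bond n) :=
  Nat.leRec_succ _ _ h

/-- The constant sequence `H ← H ← H ← ⋯` with identity bonds. -/
def const (H : Type u) [Group H] : InverseSequence.{u} where
  obj := fun _ => H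
  bond := fun _ => MonoidHom.id H

/-- Two inverse sequences are pro-isomorphic if, after passing to subsequences, there is a
commuting ladder
`G_{i 0} ← H_{j 0} ← G_{i 1} ← H_{j 1} ← G_{i 2} ← ⋯`
whose two-step composites are the bonds of the two subsequences. -/
def ProIsomorphic (G : InverseSequence.{u}) (H : InverseSequence.{v}) : Prop :=
  ∃ (i j : ℕ → ℕ) (hi : StrictMono i) (hj : StrictMono j)
    (up : ∀ k, H.obj (j k) →* G.obj (i k))
    (down : ∀ k, G.obj (i (k + 1)) →* H.obj (j k)),
    (∀ k, (up k).comp (down k) = G.comp (hi.monotone k.le_succ)) ∧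
    (∀ k, (down k).comp (up (k + 1)) = H.comp (hj.monotone k.le_succ))

/-- An inverse sequence is stable if it is pro-isomorphic to a constant one. -/
def Stable (G : InverseSequence.{u}) : Prop :=
  ∃ (H : Type u) (_ : Group H), G.ProIsomorphic (const H)

/-- An inverse sequence is pro-monomorphic if it is pro-isomorphic to one whose bonds are all
injective. -/
def ProMonomorphic (G : InverseSequence.{u}) : Prop :=
  ∃ H : InverseSequence.{u}, (∀ n, Function.Injective (H.bond n)) ∧ G.ProIsomorphic H

end InverseSequence

/-! ### Ends and neighborhoods of infinity -/

section Topology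

variable (X : Type u) [TopologicalSpace X]

/-- The unbounded components of a subset `S`: those connected components of `S` whose closure
in `X` is not compact. -/
def unboundedComponents {X : Type u} [TopologicalSpace X] (S : Set X) : Set (Set X) :=
  {U | (∃ x ∈ S, connectedComponentIn S x = U) ∧ ¬ IsCompact (closure U)}

/-- `X` is one-ended: there is a compact `C` such that for every compact `D ⊇ C` the
complement of `D` has exactly one unbounded component. -/
def OneEnded : Prop :=
  ∃ C : Set X, IsCompact C ∧ ∀ D : Set X, IsCompact D → C ⊆ D →
    ∃ U : Set X, unboundedComponents Dᶜ = {U}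

/-- `N` is a neighborhood of infinity: the closure of its complement is compact. -/
def IsNhdOfInfinity {X : Type u} [TopologicalSpace X] (N : Set X) : Prop :=
  IsCompact (closure Nᶜ)

/-- The data that determine a representative of a fundamental pro-group of `X`: a nested cofinal
sequence of connected neighborhoods of infinity `N i`, base points `p i` in `N i`, and paths in
`N i` from `p i` to `p (i + 1)`. The paths, put together, form the (proper) base ray. -/
structure BasedEndSequence where
  /-- The neighborhoods of infinity. -/
  N : ℕ → Set X
  isNhdOfInfinity : ∀ i, IsNhdOfInfinity (N i)
  isConnected : ∀ i, IsConnected (N i)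
  subset_interior : ∀ i, N (i + 1) ⊆ interior (N i)
  /-- Every compact set is missed by some `N i`. -/
  cofinal : ∀ K : Set X, IsCompact K → ∃ i, Disjoint (N i) K
  /-- The base points. -/
  p : ∀ i, N i
  /-- The pieces of the base ray. -/
  path : ∀ i, Path (p i)
    (Set.inclusion ((subset_interior i).trans interior_subset) (p (i + 1)))

namespace BasedEndSequence

variable {X}
variable (E : BasedEndSequence X)

theorem subset (i : ℕ) : E.N (i + 1) ⊆ E.N i :=
  (E.subset_interior i).trans interior_subset

/-- The inclusion `N (i + 1) → N i`. -/
def incl (i : ℕ) : C(E.N (i + 1), E.N i) :=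
  ⟨Set.inclusion (E.subset i), continuous_inclusion (E.subset i)⟩

/-- The inverse sequence `π₁(N 0, p 0) ← π₁(N 1, p 1) ← ⋯`. Each bond is induced by inclusion
and followed by the change of base point along the chosen path. -/
noncomputable def proPi1 : InverseSequence.{u} where
  obj := fun i => FundamentalGroup (E.N i) (E.p i)
  bond := fun i =>
    (FundamentalGroup.fundamentalGroupMulEquivOfPath (E.path i).symm).toMonoidHom.comp
      (FundamentalGroup.map (E.incl i) (E.p (i + 1)))

end BasedEndSequence

/-- `X` has pro-monomorphic fundamental group at infinity: for some base ray, the fundamental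
pro-group has a pro-monomorphic representative. (For one-ended spaces this does not depend on
the choices.) -/
def HasProMonomorphicPi1AtInfinity : Prop :=
  ∃ E : BasedEndSequence X, E.proPi1.ProMonomorphic

/-- `X` has stable fundamental group at infinity: base rays exist, and for every choice of base
ray and of representative the fundamental pro-group is stable. -/
def HasStablePi1AtInfinity : Prop :=
  Nonempty (BasedEndSequence X) ∧ ∀ E : BasedEndSequence X, E.proPi1.Stable

/-- The group `G` acts on `X` by covering transformations: by homeomorphisms, freely and
properly discontinuously. -/
structure ActsByCoveringTransformations (G : Type v) [AddGroup G] [AddAction G X] : Prop where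
  continuous_vadd : ∀ g : G, Continuous fun x : X => g +ᵥ x
  free : ∀ (g : G) (x : X), g +ᵥ x = x → g = 0
  properlyDiscontinuous : ∀ K : Set X, IsCompact K →
    {g : G | (((fun x : X => g +ᵥ x) '' K) ∩ K).Nonempty}.Finite

end Topology

/-! ### Algebra of inverse sequences: stability from kernels and images. -/

namespace InverseSequence

/-! Stability splits into two conditions: kernels to a fixed term die after finitely many steps, and
images in that term stabilise (Mittag-Leffler). Pro-monomorphy says that, for some compact `C`,
far-out loops contracting outside `C` contract far out (`exists_detectsLoops`). This mentions only
compact sets, so it passes to every base ray and gives the kernel condition. The action is needed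
for the images.

If all translates of a loop to one side of 0 stay far out, contract the loop in the simply connected
`X` and translate the contraction off `C`. Detection pushes it off a translate of `C` by one step;
translating back one step at a time shows that the loop itself contracts outside `C`
(`DetectsLoops.nullIn_compl`). Hence paths on one side are determined up to homotopy by their
endpoints.

The two sides cover a neighborhood of infinity and overlap in the points whose whole orbit is far
out. Deep components of this overlap are invariant under a nonzero translation
(`EndConnected.exists_isCompact_forall_joinedIn_vadd`). A path on one side with endpoints in such
components is therefore homotopic to one that follows the orbits outward, crosses along a distant
translate of itself, and returns, missing any prescribed compact set. Cutting a path at overlap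
points pushes arbitrary far-out loops, and the base ray, off that compact set
(`SidesSimplyConnected.liesIn_compl_of_liesIn_union`), which yields the image condition. -/

theorem comp_comp (G : InverseSequence.{u}) {l m n : ℕ} (h : l ≤ m) (h' : m ≤ n) :
    (G.comp h).comp (G.comp h') = G.comp (h.trans h') := by
  induction n, h' using Nat.le_induction with
  | base => rw [comp_self]; rfl
  | succ n hn ih => rw [comp_succ G hn, ← MonoidHom.comp_assoc, ih, ← comp_succ G (h.trans hn)]

theorem comp_comp_apply (G : InverseSequence.{u}) {l m n : ℕ} (h : l ≤ m) (h' : m ≤ n)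
    (g : G.obj n) : G.comp h (G.comp h' g) = G.comp (h.trans h') g :=
  DFunLike.congr_fun (comp_comp G h h') g

theorem comp_injective (G : InverseSequence.{u}) (hG : ∀ n, Function.Injective (G.bond n))
    {m n : ℕ} (h : m ≤ n) : Function.Injective (G.comp h) := by
  induction n, h using Nat.le_induction with
  | base => rw [comp_self]; exact Function.injective_id
  | succ n hn ih => rw [comp_succ G hn]; exact ih.comp (hG n)

theorem const_comp (H : Type u) [Group H] {m n : ℕ} (h : m ≤ n) :
    (const H).comp h = MonoidHom.id H := by
  induction n, h using Nat.le_induction with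
  | base => rw [comp_self]; rfl
  | succ n hn ih => rw [comp_succ _ hn, ih]; rfl

/-- In a pro-monomorphic sequence, some `G_m` detects triviality in all later terms. -/
theorem ProMonomorphic.exists_ker_le {G : InverseSequence.{u}} (hG : G.ProMonomorphic) :
    ∃ m, ∀ i, m ≤ i → ∃ k, ∃ hik : i ≤ k, ∃ hmk : m ≤ k, ∀ g : G.obj k,
      G.comp hmk g = 1 → G.comp hik g = 1 := by
  obtain ⟨H, hH, i, j, hi, hj, up, down, hud, hdu⟩ := hG
  have key : ∀ n (g : G.obj (i (n + 1))), H.comp (hj.monotone n.zero_le) (down n g) =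
      down 0 (G.comp (hi.monotone (by omega : 0 + 1 ≤ n + 1)) g) := by
    intro n
    induction n with
    | zero => intro g; rw [comp_self, comp_self]; rfl
    | succ n ih =>
      intro g
      rw [← comp_comp_apply H (hj.monotone n.zero_le) (hj.monotone n.le_succ), ← hdu]
      have h2 := DFunLike.congr_fun (hud (n + 1)) g
      simp only [MonoidHom.comp_apply] at h2 ⊢
      rw [h2, ih, comp_comp_apply]
  -- `G_{i 1}` is the first term mapping to `H_{j 0}`. By injectivity in `H`, what dies there dies
  -- in `H_{j n}`, hence in `G_{i n}` and in `G_n`.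
  refine ⟨i (0 + 1), fun n _ => ⟨i (n + 1), ?_, hi.monotone (by omega), fun g hg => ?_⟩⟩
  · exact (hi.le_apply).trans (hi.monotone n.le_succ)
  · have h1 := key n g
    rw [hg, map_one] at h1
    have h2 : down n g = 1 := comp_injective H hH _ (h1.trans (map_one _).symm)
    have h3 := DFunLike.congr_fun (hud n) g
    rw [MonoidHom.comp_apply, h2, map_one] at h3
    rw [← comp_comp_apply G hi.le_apply (hi.monotone n.le_succ), ← h3, map_one]

/-- A sequence whose kernels and images both stabilise is stable. -/
theorem stable_of_ker_le_of_range_le {G : InverseSequence.{u}} (m : ℕ)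
    (hker : ∀ i, m ≤ i → ∃ k, ∃ hik : i ≤ k, ∃ hmk : m ≤ k, ∀ g : G.obj k,
      G.comp hmk g = 1 → G.comp hik g = 1)
    (hran : ∃ i, ∃ hmi : m ≤ i, ∀ k (hik : i ≤ k),
      (G.comp hmi).range ≤ (G.comp (hmi.trans hik)).range) : G.Stable := by
  obtain ⟨i₁, hmi₁, hran⟩ := hran
  choose! κ hκ hmκ hκker using hker
  -- Passing `κ (s n)` controls kernels at each step; passing `i₁` makes every image in `G_m` the
  -- stable one.
  obtain ⟨s, hs0, hs⟩ : ∃ s : ℕ → ℕ, s 0 = m ∧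
      ∀ n, s (n + 1) = max (max (s n + 1) i₁) (κ (s n)) :=
    ⟨fun n => Nat.rec m (fun _ a => max (max (a + 1) i₁) (κ a)) n, rfl, fun _ => rfl⟩
  have hsm : StrictMono s := strictMono_nat_of_lt_succ fun n => by rw [hs]; omega
  have hms : ∀ n, m ≤ s n := fun n => hs0 ▸ hsm.monotone n.zero_le
  have his : ∀ n, i₁ ≤ s (n + 1) := fun n => by rw [hs]; omega
  have hker : ∀ n (g : G.obj (s (n + 1))), G.comp (hms (n + 1)) g = 1 →
      G.comp (hsm.monotone n.le_succ) g = 1 := by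
    intro n g hg
    have hκs : κ (s n) ≤ s (n + 1) := by rw [hs]; omega
    rw [← comp_comp_apply G (hκ _ (hms n)) hκs]
    refine hκker _ (hms n) _ ?_
    rw [comp_comp_apply]; exact hg
  let H := (G.comp hmi₁).range
  have hdown : ∀ n (g : G.obj (s (n + 1))), G.comp (hms (n + 1)) g ∈ H := fun n g =>
    ⟨G.comp (his n) g, by rw [comp_comp_apply]⟩
  have hlift : ∀ n (h : H), ∃ g : G.obj (s (n + 1)), G.comp (hms (n + 1)) g = h := fun n h =>
    hran _ (his n) h.2
  choose lift hl using hlift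
  have hwd : ∀ n (g g' : G.obj (s (n + 1))), G.comp (hms (n + 1)) g = G.comp (hms (n + 1)) g' →
      G.comp (hsm.monotone n.le_succ) g = G.comp (hsm.monotone n.le_succ) g' := by
    intro n g g' h
    rw [← mul_inv_eq_one, ← map_inv, ← map_mul]
    apply hker
    rw [map_mul, map_inv, h, mul_inv_cancel]
  -- Two lifts differ by an element of the kernel to `G_m`, which dies one step down; the choice of
  -- lift is thus harmless and the map multiplicative.
  let up : ∀ n, H →* G.obj (s n) := fun n =>
    MonoidHom.mk' (fun h => G.comp (hsm.monotone n.le_succ) (lift n h)) fun a b => by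
      rw [← map_mul]
      apply hwd
      rw [map_mul, hl, hl, hl]; rfl
  refine ⟨H, inferInstance, s, id, hsm, strictMono_id, up,
    fun n => (G.comp (hms (n + 1))).codRestrict H (hdown n), fun n => ?_, fun n => ?_⟩
  · ext g
    exact hwd n _ _ (hl n _)
  · rw [const_comp]
    refine MonoidHom.ext fun h => Subtype.ext ?_
    change G.comp (hms (n + 1)) (G.comp (hsm.monotone (n + 1).le_succ) (lift (n + 1) h)) = _
    rw [comp_comp_apply]
    exact hl (n + 1) h

end InverseSequence

/-! ### Orbits, the two sides of the action, and proper discontinuity. -/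

section Action

open Set

variable {X : Type u} [AddAction ℤ X]

/-- The points none of whose translates by elements of `I` lies in `D`. -/
def avoid (I : Set ℤ) (D : Set X) : Set X := {x | ∀ n ∈ I, n +ᵥ x ∉ D}

theorem avoid_mono {I J : Set ℤ} (hIJ : J ⊆ I) {D E : Set X} (hDE : E ⊆ D) :
    avoid I D ⊆ avoid J E := fun _ hx n hn h => hx n (hIJ hn) (hDE h)

theorem avoid_subset_compl {I : Set ℤ} (hI : 0 ∈ I) (D : Set X) : avoid I D ⊆ Dᶜ :=
  fun x hx h => hx 0 hI (by rwa [zero_vadd])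

theorem vadd_mem_avoid_univ {D : Set X} (n : ℤ) {x : X} (hx : x ∈ avoid univ D) :
    n +ᵥ x ∈ avoid univ D := fun m _ => by
  rw [vadd_vadd]; exact hx _ (mem_univ _)

theorem not_mem_avoid_univ {D : Set X} {x : X} : x ∉ avoid univ D ↔ ∃ n : ℤ, n +ᵥ x ∈ D := by
  simp [avoid]

/-- The integers on the side of `0` given by the sign of `s`. -/
def side (s : ℤ) : Set ℤ := {n | 0 ≤ s * n}

theorem zero_mem_side (s : ℤ) : (0 : ℤ) ∈ side s := by simp [side]

theorem mul_nat_mem_side (s : ℤ) (n : ℕ) : s * n ∈ side s := by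
  simp only [side, mem_ofPred_eq]
  rw [← mul_assoc]
  exact mul_nonneg (mul_self_nonneg s) n.cast_nonneg

theorem add_mem_side {s m n : ℤ} (hm : m ∈ side s) (hn : n ∈ side s) : m + n ∈ side s := by
  simp only [side, mem_ofPred_eq, mul_add] at *
  exact add_nonneg hm hn

theorem vadd_mem_avoid_side {s n : ℤ} (hn : n ∈ side s) {D : Set X} {x : X}
    (hx : x ∈ avoid (side s) D) : n +ᵥ x ∈ avoid (side s) D := fun m hm => by
  rw [vadd_vadd]; exact hx _ (add_mem_side hm hn)

theorem avoid_side_inter {D : Set X} :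
    avoid (side 1) D ∩ avoid (side (-1)) D = avoid univ D := by
  ext x
  refine ⟨fun h n _ => ?_, fun h => ⟨fun n _ => h n (mem_univ _), fun n _ => h n (mem_univ _)⟩⟩
  rcases le_total 0 n with hn | hn
  · exact h.1 n (by simpa [side] using hn)
  · exact h.2 n (by simpa [side] using hn)

variable [TopologicalSpace X]

section

variable [ContinuousConstVAdd ℤ X]

theorem JoinedIn.vadd {D : Set X} {x y : X} (h : JoinedIn (avoid univ D) x y) (n : ℤ) :
    JoinedIn (avoid univ D) (n +ᵥ x) (n +ᵥ y) :=
  (h.map (continuous_const_vadd n)).mono (by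
    rintro _ ⟨z, hz, rfl⟩; exact vadd_mem_avoid_univ n hz)

/-- A path from `q` to a translate of `q` can be iterated. -/
theorem JoinedIn.mul_vadd {D : Set X} {q : X} {k : ℤ}
    (h : JoinedIn (avoid univ D) q (k +ᵥ q)) (m : ℤ) :
    JoinedIn (avoid univ D) q ((m * k) +ᵥ q) := by
  induction m using Int.induction_on with
  | zero => simpa using JoinedIn.refl h.source_mem
  | succ m ih =>
    refine ih.trans ?_
    have := h.vadd (m * k)
    rwa [vadd_vadd, show (m : ℤ) * k + k = (m + 1) * k by ring] at this
  | pred m ih =>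
    refine ih.trans ?_
    have := (h.vadd ((-m - 1) * k)).symm
    rwa [vadd_vadd, show (-(m : ℤ) - 1) * k + k = -m * k by ring] at this

end

variable [ProperlyDiscontinuousVAdd ℤ X]

theorem finite_vadd_mem {K L : Set X} (hK : IsCompact K) (hL : IsCompact L) :
    {n : ℤ | ∃ x ∈ K, n +ᵥ x ∈ L}.Finite := by
  refine (ProperlyDiscontinuousVAdd.finite_disjoint_inter_image (Γ := ℤ) hK hL).subset ?_
  rintro n ⟨x, hx, hn⟩
  exact mem_ofPred.2 ⟨n +ᵥ x, ⟨x, hx, rfl⟩, hn⟩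

theorem exists_nat_forall_vadd_notMem {K L : Set X} (hK : IsCompact K) (hL : IsCompact L) :
    ∃ N : ℕ, ∀ n : ℤ, (N : ℤ) ≤ |n| → ∀ x ∈ K, n +ᵥ x ∉ L := by
  obtain ⟨N, hN⟩ := ((finite_vadd_mem hK hL).image (fun n => n.natAbs)).bddAbove
  refine ⟨N + 1, fun n hn x hx h => ?_⟩
  have := hN (mem_image_of_mem _ (show n ∈ {n : ℤ | ∃ x ∈ K, n +ᵥ x ∈ L} from ⟨x, hx, h⟩))
  rw [Int.abs_eq_natAbs] at hn
  omega

/-- The points with translates in `E` on both sides of `0` form a relatively compact set. -/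
theorem exists_isCompact_compl_subset_avoid_union [ContinuousConstVAdd ℤ X] {E : Set X}
    (hE : IsCompact E) :
    ∃ L : Set X, IsCompact L ∧ Lᶜ ⊆ avoid (side 1) E ∪ avoid (side (-1)) E := by
  obtain ⟨N, hN⟩ := exists_nat_forall_vadd_notMem hE hE
  refine ⟨⋃ n ∈ (Icc (-N : ℤ) N), (fun x : X => n +ᵥ x) '' E,
    (finite_Icc _ _).isCompact_biUnion fun n _ => hE.image (continuous_const_vadd n), ?_⟩
  intro x hx
  by_contra hxu
  simp only [mem_union, avoid, mem_ofPred_eq, not_or, not_forall, not_not, side] at hxu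
  obtain ⟨⟨a, ha, hxa⟩, b, hb, hxb⟩ := hxu
  -- Two translates of one point in `E` differ by a bounded shift; as `b ≤ 0 ≤ a`, this bounds `a`.
  have h1 : ¬ (N : ℤ) ≤ |b - a| := fun h => hN _ h _ hxa (by
    rw [vadd_vadd, sub_add_cancel]; exact hxb)
  have h2 : a ≤ N := by
    by_contra h; apply h1; rw [abs_sub_comm, abs_of_nonneg] <;> omega
  refine hx (mem_biUnion (x := -a) ⟨by omega, by omega⟩ ⟨a +ᵥ x, hxa, by simp⟩)

variable [ContinuousConstVAdd ℤ X] [LocallyCompactSpace X] [T2Space X]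

/-- Only finitely many translates of `D` meet a compact neighborhood of a point, so locally this is
a finite intersection of open sets. -/
theorem isOpen_avoid (I : Set ℤ) {D : Set X} (hD : IsCompact D) : IsOpen (avoid I D) := by
  rw [isOpen_iff_mem_nhds]
  intro x hx
  obtain ⟨K, hK, hxK⟩ := exists_compact_mem_nhds x
  have hfin := (finite_vadd_mem hK hD).inter_of_left I
  have h : (⋂ n ∈ {n : ℤ | ∃ x ∈ K, n +ᵥ x ∈ D} ∩ I, (fun y : X => n +ᵥ y) ⁻¹' Dᶜ) ∈ nhds x :=
    (Filter.biInter_mem hfin).2 fun n hn =>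
      (hD.isClosed.isOpen_compl.preimage (continuous_const_vadd n)).mem_nhds (hx n hn.2)
  filter_upwards [h, hxK] with y hy hyK n hn hny
  exact mem_iInter₂.1 hy n ⟨⟨y, hyK, hny⟩, hn⟩ hny

end Action

/-! ### Components of the set of points with far-out orbits. -/

section Components

open Set

/-- Any two points far enough out can be joined far out. -/
def EndConnected (X : Type u) [TopologicalSpace X] : Prop :=
  ∀ K : Set X, IsCompact K → ∃ K' : Set X, IsCompact K' ∧ K ⊆ K' ∧
    ∀ x ∉ K', ∀ y ∉ K', JoinedIn Kᶜ x y

/-- The preimage of `V` under the path is clopen in the interval. This serves to show that a path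
missing a frontier cannot leave a region. -/
theorem JoinedIn.mem_of_isClopen_relative {X : Type u} [TopologicalSpace X] {S V : Set X}
    {x y : X} (h : JoinedIn S x y) (hV : IsOpen V) (hcl : closure V ∩ S ⊆ V) (hx : x ∈ V) :
    y ∈ V := by
  obtain ⟨γ, hγ⟩ := h
  have h1 : IsClopen (γ ⁻¹' V) := by
    refine ⟨?_, hV.preimage γ.continuous⟩
    have : γ ⁻¹' V = γ ⁻¹' closure V :=
      subset_antisymm (preimage_mono subset_closure) fun t ht => hcl ⟨ht, hγ t⟩
    rw [this]
    exact isClosed_closure.preimage γ.continuous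
  have h2 := h1.eq_univ ⟨0, by simpa using hx⟩
  have h3 : (1 : unitInterval) ∈ γ ⁻¹' V := h2 ▸ mem_univ _
  simpa using h3

variable {X : Type u} [AddAction ℤ X] [TopologicalSpace X] [ContinuousConstVAdd ℤ X]

theorem vadd_mem_closure_avoid_univ {E : Set X} {x : X} (n : ℤ)
    (hx : x ∈ closure (avoid univ E)) : n +ᵥ x ∈ closure (avoid univ E) :=
  map_mem_closure (continuous_const_vadd n) hx fun _ hy => vadd_mem_avoid_univ n hy

/-- A translate of `x` in the open set `interior E` would force the same for nearby points of `avoid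
univ E`. Frontier points thus still lie in components of `avoid univ D`. -/
theorem closure_avoid_subset {D E : Set X} (hDE : D ⊆ interior E) :
    closure (avoid univ E) ⊆ avoid univ D := by
  intro x hx n _ hn
  have h1 := mem_closure_iff.1 (vadd_mem_closure_avoid_univ n hx) _ isOpen_interior (hDE hn)
  obtain ⟨y, hy, hyE⟩ := h1
  exact avoid_subset_compl (mem_univ _) _ hyE (interior_subset hy)

variable [ProperlyDiscontinuousVAdd ℤ X] [LocallyCompactSpace X] [T2Space X]

/-- The translates of a compact set do not cover an end-connected space. -/
theorem EndConnected.nonempty_avoid_univ [Nonempty X]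
    (hX : EndConnected X) {K : Set X} (hK : IsCompact K) : (avoid univ K).Nonempty := by
  obtain ⟨x₀⟩ : Nonempty X := inferInstance
  by_contra hne
  rw [not_nonempty_iff_eq_empty] at hne
  obtain ⟨L, hL, hLK⟩ := exists_isCompact_compl_subset_avoid_union hK
  obtain ⟨L', hL', -, hjoin⟩ := hX L hL
  obtain ⟨N, hN⟩ := exists_nat_forall_vadd_notMem isCompact_singleton (hL'.union hK) (K := {x₀})
  have hN' : ∀ n : ℤ, (N : ℤ) ≤ |n| → n +ᵥ x₀ ∉ L' ∪ K := fun n hn => hN n hn x₀ rfl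
  have hj := hjoin ((N : ℤ) +ᵥ x₀) (fun h => hN' N (by simp) (Or.inl h)) ((-N : ℤ) +ᵥ x₀)
    (fun h => hN' (-N) (by simp) (Or.inl h))
  have h1 : ((N : ℤ) +ᵥ x₀) ∈ avoid (side 1) K := by
    intro n hn h
    rw [vadd_vadd] at h
    simp only [side, mem_ofPred_eq] at hn
    exact hN' _ (by rw [abs_of_nonneg] <;> omega) (Or.inr h)
  have h2 : ((-N : ℤ) +ᵥ x₀) ∈ avoid (side (-1)) K := by
    intro n hn h
    rw [vadd_vadd] at h
    simp only [side, mem_ofPred_eq] at hn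
    exact hN' _ (by rw [abs_of_nonpos] <;> omega) (Or.inr h)
  -- If the translates of `K` covered `X`, the two sides would be disjoint and separate `Lᶜ`, yet
  -- the path joins their far ends.
  have h3 : ((-N : ℤ) +ᵥ x₀) ∈ avoid (side 1) K := by
    refine hj.mem_of_isClopen_relative (isOpen_avoid _ hK) ?_ h1
    rintro x ⟨hx, hxL⟩
    refine (hLK hxL).resolve_right fun hxB => ?_
    obtain ⟨y, hy⟩ := mem_closure_iff.1 hx _ (isOpen_avoid _ hK) hxB
    rw [inter_comm, avoid_side_inter, hne] at hy
    exact hy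
  have h4 : ((-N : ℤ) +ᵥ x₀) ∈ avoid univ K := by
    rw [← avoid_side_inter]; exact ⟨h3, h2⟩
  rw [hne] at h4
  exact h4

variable [LocallyPathConnectedSpace X]

/-- A path leaving the part of a component of `avoid univ D` outside the translates of `E` crosses
the frontier of those translates inside that component. -/
theorem mem_component_of_joinedIn {D E : Set X} (hD : IsCompact D) (hE : IsCompact E)
    (hDE : D ⊆ interior E) {q z : X} (hq : q ∈ avoid univ E) {S : Set X} (hS : JoinedIn S q z)
    (hcross : ∀ x ∈ closure (avoid univ E), x ∉ avoid univ E → JoinedIn (avoid univ D) q x →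
      x ∉ S) : JoinedIn (avoid univ D) q z ∧ z ∈ avoid univ E := by
  have hqD : q ∈ avoid univ D := closure_avoid_subset hDE (subset_closure hq)
  have hopen := isOpen_avoid univ hD
  refine hS.mem_of_isClopen_relative (V := pathComponentIn (avoid univ D) q ∩ avoid univ E)
    ((hopen.pathComponentIn q).inter (isOpen_avoid univ hE)) ?_ ⟨mem_pathComponentIn_self hqD, hq⟩
  rintro x ⟨hx, hxS⟩
  have hxE : x ∈ closure (avoid univ E) := closure_mono inter_subset_right hx
  have hxD := closure_avoid_subset hDE hxE
  obtain ⟨y, hy, hyq, -⟩ := mem_closure_iff.1 hx _ (hopen.pathComponentIn x)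
    (mem_pathComponentIn_self hxD)
  have hqx : JoinedIn (avoid univ D) q x := JoinedIn.trans hyq (JoinedIn.symm hy)
  exact ⟨hqx, by_contra fun h => hcross x hxE h hqx hxS⟩

/-- Finitely many components of `avoid univ D`, up to translation, meet the frontier of
`avoid univ E`. -/
theorem exists_finite_frontier_components {D E : Set X} (hD : IsCompact D) (hE : IsCompact E)
    (hDE : D ⊆ interior E) :
    ∃ s : Set X, s.Finite ∧ ∀ x ∈ closure (avoid univ E), x ∉ avoid univ E →
      ∃ n : ℤ, n +ᵥ x ∈ E ∧ ∃ a ∈ s, JoinedIn (avoid univ D) a (n +ᵥ x) := by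
  -- Every frontier point has a translate in this compact piece of the frontier.
  have hA : IsCompact (E ∩ closure (avoid univ E)) := hE.inter_right isClosed_closure
  obtain ⟨t, htA, ht⟩ := hA.elim_nhds_subcover (pathComponentIn (avoid univ D)) fun x hx =>
    ((isOpen_avoid univ hD).pathComponentIn x).mem_nhds
      (mem_pathComponentIn_self (closure_avoid_subset hDE hx.2))
  refine ⟨t, t.finite_toSet, fun x hx hxE => ?_⟩
  obtain ⟨n, hn⟩ := not_mem_avoid_univ.1 hxE
  obtain ⟨a, ha, hax⟩ := mem_iUnion₂.1 (ht ⟨hn, vadd_mem_closure_avoid_univ n hx⟩)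
  exact ⟨n, hn, a, ha, hax⟩

/-- Outside the translates of a large compact set, every component of `avoid univ D` is unbounded
modulo the action. -/
theorem exists_isCompact_forall_component_unbounded [PathConnectedSpace X] {D : Set X}
    (hD : IsCompact D) :
    ∃ E : Set X, IsCompact E ∧ D ⊆ E ∧ ∀ q ∈ avoid univ E, ∀ K : Set X, IsCompact K →
      ∃ q' ∈ avoid univ K, JoinedIn (avoid univ D) q q' := by
  obtain ⟨x₀⟩ : Nonempty X := inferInstance
  obtain ⟨E₀, hE₀, hDE₀⟩ := exists_compact_superset (hD.insert x₀)
  have hDE : D ⊆ interior E₀ := (subset_insert _ _).trans hDE₀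
  have hx₀ : x₀ ∈ E₀ := interior_subset (hDE₀ (mem_insert _ _))
  obtain ⟨s, hs, hsE⟩ := exists_finite_frontier_components hD hE₀ hDE
  -- `K` witnesses that the component of `a` is bounded modulo translation, if it is; otherwise the
  -- empty set is a dummy.
  have hK : ∀ a : X, ∃ K : Set X, IsCompact K ∧
      ((∃ L : Set X, IsCompact L ∧ ∀ q' ∈ avoid univ L, ¬ JoinedIn (avoid univ D) a q') →
        ∀ q' ∈ avoid univ K, ¬ JoinedIn (avoid univ D) a q') := by
    intro a
    by_cases h : ∃ L : Set X, IsCompact L ∧ ∀ q' ∈ avoid univ L, ¬ JoinedIn (avoid univ D) a q'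
    · obtain ⟨L, hL, h⟩ := h
      exact ⟨L, hL, fun _ => h⟩
    · exact ⟨∅, isCompact_empty, fun h' => (h h').elim⟩
  choose κ hκ hκs using hK
  refine ⟨E₀ ∪ ⋃ a ∈ s, κ a, hE₀.union (hs.isCompact_biUnion fun a _ => hκ a),
    (hDE.trans interior_subset).trans subset_union_left, fun q hq K hK => ?_⟩
  have hqE₀ : q ∈ avoid univ E₀ := avoid_mono subset_rfl subset_union_left hq
  -- A path from `q` to `x₀ ∈ E₀` has to cross the frontier, so the component of `q` is a translate
  -- of one of the finitely many.
  obtain ⟨x, hx, hxE, hqx⟩ : ∃ x ∈ closure (avoid univ E₀), x ∉ avoid univ E₀ ∧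
      JoinedIn (avoid univ D) q x := by
    by_contra! h
    have := mem_component_of_joinedIn hD hE₀ hDE hqE₀
      (joinedIn_univ.2 (PathConnectedSpace.joined q x₀)) fun x hx hxE hqx => (h x hx hxE hqx).elim
    exact avoid_subset_compl (mem_univ _) _ this.2 hx₀
  obtain ⟨n, -, a, ha, hax⟩ := hsE x hx hxE
  have haq : JoinedIn (avoid univ D) a (n +ᵥ q) := hax.trans (hqx.vadd n).symm
  by_contra! h
  refine hκs a ⟨K, hK, fun q' hq' haq' => ?_⟩ (n +ᵥ q) ?_ haq
  · refine h (-n +ᵥ q') (vadd_mem_avoid_univ _ hq') ?_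
    simpa using (haq.symm.trans haq').vadd (-n)
  · exact vadd_mem_avoid_univ n
      (avoid_mono subset_rfl ((subset_biUnion_of_mem ha).trans subset_union_right) hq)

/-- In an end-connected space, components far from the translates of `K` are invariant under some
nontrivial translation. -/
theorem EndConnected.exists_isCompact_forall_joinedIn_vadd [PathConnectedSpace X]
    (hX : EndConnected X) {K : Set X} (hK : IsCompact K) :
    ∃ E : Set X, IsCompact E ∧ K ⊆ E ∧ ∀ q ∈ avoid univ E, ∃ k : ℤ, 0 < k ∧
      JoinedIn (avoid univ K) q (k +ᵥ q) := by
  obtain ⟨E₀, hE₀, hKE₀⟩ := exists_compact_superset hK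
  obtain ⟨E₁, hE₁, hKE₁, hub⟩ := exists_isCompact_forall_component_unbounded hK
  obtain ⟨s, hs, hsE⟩ := exists_finite_frontier_components hK hE₀ hKE₀
  refine ⟨E₁, hE₁, hKE₁, fun q hq => ?_⟩
  by_contra! h
  have hne : ∀ k : ℤ, JoinedIn (avoid univ K) q (k +ᵥ q) → k = 0 := by
    intro k hk
    rcases lt_trichotomy k 0 with h0 | h0 | h0
    · refine (h (-k) (by omega) ?_).elim
      simpa using (hk.vadd (-k)).symm
    · exact h0
    · exact (h k h0 hk).elim
  -- With trivial stabiliser, at most one translate of the component of `q` contains `a`; its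
  -- frontier then lies in the compact `F` below.
  have huniq : ∀ a : X, ∃ m : ℤ, ∀ n : ℤ, JoinedIn (avoid univ K) a (n +ᵥ q) → n = m := by
    intro a
    by_cases ha : ∃ m : ℤ, JoinedIn (avoid univ K) a (m +ᵥ q)
    · obtain ⟨m, hm⟩ := ha
      refine ⟨m, fun n hn => ?_⟩
      have := (hm.symm.trans hn).vadd (-m)
      rw [vadd_vadd, vadd_vadd, neg_add_cancel, zero_vadd] at this
      have := hne _ this
      omega
    · exact ⟨0, fun n hn => (ha ⟨n, hn⟩).elim⟩
  choose μ hμ using huniq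
  let F : Set X := ⋃ a ∈ s, (fun x : X => -μ a +ᵥ x) '' E₀
  have hF : IsCompact F := hs.isCompact_biUnion fun a _ => hE₀.image (continuous_const_vadd _)
  obtain ⟨F', hF', -, hjoin⟩ := hX F hF
  obtain ⟨q', hq', hqq'⟩ := hub q hq (F' ∪ E₀) (hF'.union hE₀)
  have hq'F : ∀ n : ℤ, n +ᵥ q' ∉ F' := fun n hn => hq' n (mem_univ _) (Or.inl hn)
  have hq'E : q' ∈ avoid univ E₀ := avoid_mono subset_rfl subset_union_right hq'
  -- A path from `q'` to its translate by 1 off `F` cannot leave the component, so translation by 1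
  -- preserves it: a contradiction.
  have hj := hjoin q' (by simpa using hq'F 0) ((1 : ℤ) +ᵥ q') (hq'F 1)
  have := (mem_component_of_joinedIn hK hE₀ hKE₀ hq'E hj ?_).1
  · have h1 := hqq'.trans (this.trans (hqq'.vadd 1).symm)
    exact one_ne_zero (hne 1 h1)
  · intro x hx hxE hqx hxF
    obtain ⟨n, hn, a, ha, hax⟩ := hsE x hx hxE
    have : n = μ a := hμ a n (hax.trans ((hqq'.trans hqx).vadd n).symm)
    exact hxF (mem_biUnion ha ⟨n +ᵥ x, hn, by simp [this]⟩)

end Components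

/-! ### Fundamental groupoids of subsets, and contractions with controlled support. -/

section Groupoid

open Set CategoryTheory unitInterval

variable {X : Type u} [TopologicalSpace X]

/-- The functor of fundamental groupoids induced by an inclusion of subsets. -/
noncomputable def inclFunctor {S T : Set X} (h : S ⊆ T) :
    FundamentalGroupoid S ⥤ FundamentalGroupoid T :=
  FundamentalGroupoid.map ⟨Set.inclusion h, continuous_inclusion h⟩

theorem inclFunctor_map_map {R S T : Set X} (h : R ⊆ S) (h' : S ⊆ T) {x y : FundamentalGroupoid R}
    (f : x ⟶ y) : (inclFunctor h').map ((inclFunctor h).map f) =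
      (inclFunctor (h.trans h')).map f := by
  rcases f with ⟨γ⟩; rfl

/-- A morphism of the fundamental groupoid of `A` lies in `S` if it is represented by a path
in `S`. -/
def LiesIn {A : Set X} (S : Set X) {x y : FundamentalGroupoid A} (f : x ⟶ y) : Prop :=
  ∃ γ : Path x.as y.as, (∀ t, (γ t : X) ∈ S) ∧ Path.Homotopic.Quotient.mk γ = f

namespace LiesIn

variable {A S T : Set X} {x y z : FundamentalGroupoid A}

theorem mono {f : x ⟶ y} (h : LiesIn S f) (hST : S ⊆ T) : LiesIn T f :=
  let ⟨γ, hγ, e⟩ := h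
  ⟨γ, fun t => hST (hγ t), e⟩

theorem id (hx : (x.as : X) ∈ S) : LiesIn S (𝟙 x) := ⟨Path.refl _, fun _ => hx, rfl⟩

theorem comp {f : x ⟶ y} {g : y ⟶ z} (hf : LiesIn S f) (hg : LiesIn S g) : LiesIn S (f ≫ g) := by
  obtain ⟨γ, hγ, rfl⟩ := hf
  obtain ⟨δ, hδ, rfl⟩ := hg
  refine ⟨γ.trans δ, fun t => ?_, rfl⟩
  rw [Path.trans_apply]
  split_ifs
  · exact hγ _
  · exact hδ _

theorem inv {f : x ⟶ y} (hf : LiesIn S f) : LiesIn S (Groupoid.inv f) := by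
  obtain ⟨γ, hγ, rfl⟩ := hf
  exact ⟨γ.symm, fun t => hγ _, rfl⟩

theorem source_mem {f : x ⟶ y} (hf : LiesIn S f) : (x.as : X) ∈ S := by
  obtain ⟨γ, hγ, -⟩ := hf
  simpa using hγ 0

theorem target_mem {f : x ⟶ y} (hf : LiesIn S f) : (y.as : X) ∈ S := by
  obtain ⟨γ, hγ, -⟩ := hf
  simpa using hγ 1

theorem inclFunctor_map {B : Set X} (h : B ⊆ A) {x y : FundamentalGroupoid B} (f : x ⟶ y) :
    LiesIn B ((inclFunctor h).map f) := by
  obtain ⟨γ, rfl⟩ := Path.Homotopic.Quotient.mk_surjective f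
  exact ⟨γ.map (continuous_inclusion h), fun t => (γ t).2, rfl⟩

theorem exists_lift (h : S ⊆ A) {a b : S}
    {f : (inclFunctor h).obj ⟨a⟩ ⟶ (inclFunctor h).obj ⟨b⟩} (hf : LiesIn S f) :
    ∃ g : (⟨a⟩ : FundamentalGroupoid S) ⟶ ⟨b⟩, (inclFunctor h).map g = f := by
  obtain ⟨γ, hγ, rfl⟩ := hf
  let δ : Path a b :=
    { toFun := fun t => ⟨γ t, hγ t⟩
      continuous_toFun := (continuous_subtype_val.comp γ.continuous).subtype_mk _
      source' := Subtype.ext (show (γ 0 : X) = a by rw [γ.source]; rfl)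
      target' := Subtype.ext (show (γ 1 : X) = b by rw [γ.target]; rfl) }
  exact ⟨Path.Homotopic.Quotient.mk δ, rfl⟩

end LiesIn

theorem JoinedIn.exists_liesIn {S A : Set X} {x y : X} (h : JoinedIn S x y) (hx : x ∈ A)
    (hy : y ∈ A) (hSA : S ⊆ A) :
    ∃ f : (⟨⟨x, hx⟩⟩ : FundamentalGroupoid A) ⟶ ⟨⟨y, hy⟩⟩, LiesIn S f := by
  obtain ⟨γ, hγ⟩ := h
  let δ : Path (⟨x, hx⟩ : A) ⟨y, hy⟩ :=
    { toFun := fun t => ⟨γ t, hSA (hγ t)⟩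
      continuous_toFun := γ.continuous.subtype_mk _
      source' := Subtype.ext γ.source
      target' := Subtype.ext γ.target }
  exact ⟨Path.Homotopic.Quotient.mk δ, δ, hγ, rfl⟩

/-- The loop `γ` contracts, relative to its base point, inside `S`. -/
def NullIn (S : Set X) (γ : I → X) : Prop :=
  ∃ H : I × I → X, Continuous H ∧ (∀ t, H (0, t) = γ t) ∧ (∀ t, H (1, t) = γ 0) ∧
    (∀ s, H (s, 0) = γ 0 ∧ H (s, 1) = γ 0) ∧ ∀ p, H p ∈ S

namespace NullIn

variable {S T : Set X} {γ : I → X}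

theorem mono (h : NullIn S γ) (hST : S ⊆ T) : NullIn T γ :=
  let ⟨H, h1, h2, h3, h4, h5⟩ := h
  ⟨H, h1, h2, h3, h4, fun p => hST (h5 p)⟩

theorem comp (h : NullIn S γ) {f : X → X} (hf : Continuous f) (hST : ∀ x ∈ S, f x ∈ T) :
    NullIn T (fun t => f (γ t)) :=
  let ⟨H, h1, h2, h3, h4, h5⟩ := h
  ⟨fun p => f (H p), hf.comp h1, fun t => congrArg f (h2 t), fun t => congrArg f (h3 t),
    fun s => ⟨congrArg f (h4 s).1, congrArg f (h4 s).2⟩, fun p => hST _ (h5 p)⟩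

theorem continuous (h : NullIn S γ) : Continuous γ := by
  obtain ⟨H, h1, h2, -⟩ := h
  rw [show γ = fun t => H (0, t) from funext fun t => (h2 t).symm]
  fun_prop

theorem apply_one (h : NullIn S γ) : γ 1 = γ 0 := by
  obtain ⟨H, h1, h2, h3, h4, -⟩ := h
  rw [← h2 1, (h4 0).2]

theorem of_homotopic_refl {A : Set X} {x : A} {p : Path x x} (h : p.Homotopic (Path.refl x)) :
    NullIn A (fun t => (p t : X)) := by
  obtain ⟨H⟩ := h
  refine ⟨fun q => (H q : X), by fun_prop, fun t => ?_, fun t => ?_, fun s => ⟨?_, ?_⟩,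
    fun q => (H q).2⟩
  · exact congrArg Subtype.val (H.apply_zero t)
  · exact congrArg Subtype.val ((H.apply_one t).trans p.source.symm)
  · exact congrArg Subtype.val ((H.source s).trans p.source.symm)
  · exact congrArg Subtype.val ((H.target s).trans p.source.symm)

theorem homotopic_refl {A : Set X} {x : A} {p : Path x x} (h : NullIn S (fun t => (p t : X)))
    (hSA : S ⊆ A) : p.Homotopic (Path.refl x) := by
  obtain ⟨H, h1, h2, h3, h4, h5⟩ := h
  simp only [p.source] at h3 h4
  refine ⟨⟨⟨⟨fun q => ⟨H q, hSA (h5 q)⟩, h1.subtype_mk _⟩, fun t => Subtype.ext (h2 t),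
    fun t => Subtype.ext (h3 t)⟩, ?_⟩⟩
  rintro s t (rfl | rfl)
  · refine Subtype.ext ?_
    change H (s, 0) = p 0
    rw [(h4 s).1, p.source]
  · refine Subtype.ext ?_
    change H (s, 1) = p 1
    rw [(h4 s).2, p.target]

theorem eq_id {A : Set X} {x : A} {p : Path x x} (h : NullIn S (fun t => (p t : X)))
    (hSA : S ⊆ A) :
    Path.Homotopic.Quotient.mk p = 𝟙 (⟨x⟩ : FundamentalGroupoid A) :=
  Path.Homotopic.Quotient.eq.2 (h.homotopic_refl hSA)

theorem exists_isCompact [SimplyConnectedSpace X] {γ : I → X} (hγ : Continuous γ)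
    (h : γ 1 = γ 0) : ∃ K : Set X, IsCompact K ∧ NullIn K γ := by
  let p : Path (γ 0) (γ 0) := ⟨⟨γ, hγ⟩, rfl, h⟩
  obtain ⟨H⟩ := SimplyConnectedSpace.paths_homotopic p (Path.refl _)
  exact ⟨range H, isCompact_range H.continuous, H, H.continuous, H.apply_zero, H.apply_one,
    fun s => ⟨H.source s, H.target s⟩, mem_range_self⟩

end NullIn

/-- Loops outside `D'` that contract outside `C` contract outside `D`. -/
def DetectsLoops (C D D' : Set X) : Prop :=
  ∀ γ : I → X, (∀ t, γ t ∉ D') → NullIn Cᶜ γ → NullIn Dᶜ γ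

section Action

variable [AddAction ℤ X] [ContinuousConstVAdd ℤ X] [ProperlyDiscontinuousVAdd ℤ X]
  [SimplyConnectedSpace X]

/-- Loops all of whose translates to one side stay far out contract outside `C`. -/
theorem DetectsLoops.nullIn_compl {C D D' : Set X} (hC : IsCompact C) (h : DetectsLoops C D D')
    {s : ℤ} (hs : |s| = 1) (hCD : ∀ x ∈ C, s +ᵥ x ∈ D) {γ : I → X} (hγ : Continuous γ)
    (hγ1 : γ 1 = γ 0) (hγD : ∀ t, γ t ∈ avoid (side s) D') : NullIn Cᶜ γ := by
  obtain ⟨K, hK, hKγ⟩ := NullIn.exists_isCompact hγ hγ1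
  obtain ⟨N, hN⟩ := exists_nat_forall_vadd_notMem hK hC
  have h1 : NullIn Cᶜ (fun t => (s * (N : ℤ)) +ᵥ γ t) :=
    hKγ.comp (continuous_const_vadd _) fun x hx => hN _ (by simp [abs_mul, hs]) x hx
  clear hN
  induction N with
  | zero => simpa using h1
  | succ N ih =>
    refine ih ?_
    -- Detection improves the contraction from off `C` to off `D`; since `D` contains the
    -- `s`-translate of `C`, shifting back by `-s` is again off `C`.
    have h2 := (h _ (fun t => hγD t _ (mul_nat_mem_side s _)) h1).comp
      (continuous_const_vadd (-s)) (T := Cᶜ) fun x hx hxC => hx (by simpa using hCD _ hxC)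
    refine Eq.mp (congrArg _ (funext fun t => ?_)) h2
    rw [vadd_vadd]
    congr 1
    push_cast
    ring

theorem DetectsLoops.eq_of_liesIn {C D D' A : Set X} (hC : IsCompact C) (h : DetectsLoops C D D')
    {s : ℤ} (hs : |s| = 1) (hCD : ∀ x ∈ C, s +ᵥ x ∈ D) (hA : Cᶜ ⊆ A)
    {x y : FundamentalGroupoid A} {f g : x ⟶ y} (hf : LiesIn (avoid (side s) D') f)
    (hg : LiesIn (avoid (side s) D') g) : f = g := by
  obtain ⟨p, hp, he⟩ := hf.comp hg.inv
  have h1 : NullIn Cᶜ _ := h.nullIn_compl hC hs hCD (γ := fun t => (p t : X))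
    (by fun_prop) (by simp) hp
  have h2 : f ≫ Groupoid.inv g = 𝟙 _ := he ▸ NullIn.eq_id h1 hA
  rw [← Category.comp_id f, ← Groupoid.inv_comp g, ← Category.assoc, h2, Category.id_comp]

end Action

namespace BasedEndSequence

variable (E : BasedEndSequence X)

theorem antitone : Antitone E.N := antitone_nat_of_succ_le E.subset

theorem isCompact_closure_compl (i : ℕ) : IsCompact (closure (E.N i)ᶜ) := E.isNhdOfInfinity i

theorem exists_proPi1_bond_apply (i : ℕ) :
    ∃ q : (⟨E.p i⟩ : FundamentalGroupoid (E.N i)) ⟶ (inclFunctor (E.subset i)).obj ⟨E.p (i + 1)⟩,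
      ∀ g : E.proPi1.obj (i + 1), (E.proPi1.bond i g : FundamentalGroup (E.N i) (E.p i)) =
        q ≫ (inclFunctor (E.subset i)).map (X := ⟨E.p (i + 1)⟩) (Y := ⟨E.p (i + 1)⟩) g ≫
          Groupoid.inv q := by
  let r : (inclFunctor (E.subset i)).obj ⟨E.p (i + 1)⟩ ⟶
      (⟨E.p i⟩ : FundamentalGroupoid (E.N i)) := Path.Homotopic.Quotient.mk (E.path i).symm
  refine ⟨Groupoid.inv r, fun g => ?_⟩
  have hr : Groupoid.inv (Groupoid.inv r) = r := by simp
  rw [hr]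
  rfl

end BasedEndSequence

end Groupoid

/-! ### Translating pro-group statements into statements about compact sets. -/

section EndSequences

open Set CategoryTheory unitInterval

theorem CategoryTheory.Groupoid.conj_eq_id_iff {C : Type*} [Groupoid C] {x y : C} (f : x ⟶ y)
    (g : y ⟶ y) : f ≫ g ≫ Groupoid.inv f = 𝟙 x ↔ g = 𝟙 y := by
  constructor
  · intro h
    have h1 := congrArg (fun k => Groupoid.inv f ≫ k ≫ f) h
    simpa using h1
  · rintro rfl
    simp

theorem CategoryTheory.Groupoid.map_conj_eq_id_iff {C D : Type*} [Groupoid C] [Groupoid D]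
    (F : C ⥤ D) {x y : C} (f : x ⟶ y) (g : y ⟶ y) :
    F.map (f ≫ g ≫ Groupoid.inv f) = 𝟙 _ ↔ F.map g = 𝟙 _ := by
  rw [← Groupoid.conj_eq_id_iff (F.map f)]
  simp

theorem CategoryTheory.Groupoid.id_conj {C : Type*} [Groupoid C] {x : C} (f : x ⟶ x) :
    𝟙 x ≫ f ≫ Groupoid.inv (𝟙 x) = f := by
  simp

theorem CategoryTheory.Groupoid.map_conj_conj {C D : Type*} [Groupoid C] [Groupoid D]
    (F : C ⥤ D) {w : D} {x y : C} (ρ : w ⟶ F.obj x) (f : x ⟶ y) (g : y ⟶ y) :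
    ρ ≫ F.map (f ≫ g ≫ Groupoid.inv f) ≫ Groupoid.inv ρ =
      (ρ ≫ F.map f) ≫ F.map g ≫ Groupoid.inv (ρ ≫ F.map f) := by
  simp

variable {X : Type u} [TopologicalSpace X]

namespace BasedEndSequence

variable (E : BasedEndSequence X)

theorem compl_closure_compl_subset (i : ℕ) : (closure (E.N i)ᶜ)ᶜ ⊆ E.N i :=
  compl_subset_comm.1 subset_closure

theorem disjoint_mono {i j : ℕ} (hij : i ≤ j) {K : Set X} (h : Disjoint (E.N i) K) :
    Disjoint (E.N j) K := h.mono_left (E.antitone hij)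

/-- Base point changes along the ray accumulate into one conjugation, which does not affect kernels.
-/
theorem exists_comp_apply {m k : ℕ} (h : m ≤ k) :
    ∃ ρ : (⟨E.p m⟩ : FundamentalGroupoid (E.N m)) ⟶
        (inclFunctor (E.antitone h)).obj ⟨E.p k⟩,
      ∀ g : E.proPi1.obj k, (E.proPi1.comp h g : FundamentalGroup (E.N m) (E.p m)) =
        ρ ≫ (inclFunctor (E.antitone h)).map (X := ⟨E.p k⟩) (Y := ⟨E.p k⟩) g ≫
          Groupoid.inv ρ := by
  induction k, h using Nat.le_induction with
  | base =>
    refine ⟨𝟙 (⟨E.p m⟩ : FundamentalGroupoid (E.N m)), fun g => ?_⟩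
    rw [InverseSequence.comp_self]
    have h1 : (inclFunctor (E.antitone le_rfl)).map (X := ⟨E.p m⟩) (Y := ⟨E.p m⟩) g = g := by
      rcases g with ⟨γ⟩; rfl
    exact h1.symm.trans (Groupoid.id_conj (x := (⟨E.p m⟩ : FundamentalGroupoid (E.N m))) _).symm
  | succ k hk ih =>
    obtain ⟨ρ, hρ⟩ := ih
    obtain ⟨q, hq⟩ := E.exists_proPi1_bond_apply k
    let F := inclFunctor (E.antitone hk)
    let q' : (⟨E.p k⟩ : FundamentalGroupoid (E.N k)) ⟶
      (inclFunctor (E.subset k)).obj ⟨E.p (k + 1)⟩ := q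
    let r := ρ ≫ F.map q'
    refine ⟨r, fun g => ?_⟩
    rw [InverseSequence.comp_succ _ hk]
    refine (hρ _).trans ?_
    rw [hq]
    refine (Groupoid.map_conj_conj F ρ q' _).trans ?_
    exact congrArg (fun f => r ≫ f ≫ Groupoid.inv r) (inclFunctor_map_map (E.subset k)
      (E.antitone hk) (x := ⟨E.p (k + 1)⟩) (y := ⟨E.p (k + 1)⟩) g)

theorem comp_eq_one_iff {m k : ℕ} (h : m ≤ k) (g : E.proPi1.obj k) :
    E.proPi1.comp h g = 1 ↔
      (inclFunctor (E.antitone h)).map (X := ⟨E.p k⟩) (Y := ⟨E.p k⟩) g = 𝟙 _ := by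
  obtain ⟨ρ, hρ⟩ := E.exists_comp_apply h
  rw [← Groupoid.conj_eq_id_iff ρ, ← hρ]
  rfl

/-- Detection does not refer to a base ray, so pro-monomorphy of one end sequence controls the
kernels of every other. -/
theorem exists_ker_le {C : Set X} (hC : IsCompact C)
    (hdet : ∀ D : Set X, IsCompact D → ∃ D', IsCompact D' ∧ DetectsLoops C D D') :
    ∃ m, ∀ i, m ≤ i → ∃ k, ∃ hik : i ≤ k, ∃ hmk : m ≤ k, ∀ g : E.proPi1.obj k,
      E.proPi1.comp hmk g = 1 → E.proPi1.comp hik g = 1 := by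
  obtain ⟨m, hm⟩ := E.cofinal C hC
  refine ⟨m, fun i hi => ?_⟩
  obtain ⟨D', hD', hdet⟩ := hdet _ (E.isCompact_closure_compl i)
  obtain ⟨j, hj⟩ := E.cofinal D' hD'
  refine ⟨max i j, le_max_left _ _, hi.trans (le_max_left _ _), fun g hg => ?_⟩
  rw [comp_eq_one_iff] at hg ⊢
  obtain ⟨γ, rfl⟩ := Path.Homotopic.Quotient.mk_surjective g
  have h1 := NullIn.of_homotopic_refl (Path.Homotopic.Quotient.eq.1 hg)
  refine NullIn.eq_id (p := γ.map (continuous_inclusion (E.antitone (le_max_left i j))))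
    (hdet _ (fun t => ?_) (NullIn.mono h1 hm.subset_compl_right)) (E.compl_closure_compl_subset i)
  exact (E.disjoint_mono (le_max_right i j) hj).subset_compl_right (γ t).2

variable [LocallyPathConnectedSpace X]

/-- The index drops by one because `N (i + 1)` need not be path connected; being connected, it lies
in one path component of the open set `interior (N i)`. -/
theorem joinedIn {i : ℕ} {x y : X} (hx : x ∈ E.N (i + 1)) (hy : y ∈ E.N (i + 1)) :
    JoinedIn (E.N i) x y := by
  have hsub := E.subset_interior i
  have hx' := mem_pathComponentIn_self (hsub hx)
  have := (E.isConnected (i + 1)).isPreconnected.subset_of_closure_inter_subset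
    (isOpen_interior.pathComponentIn x) ⟨x, hx, hx'⟩ ?_ hy
  · exact JoinedIn.mono this interior_subset
  · rintro z ⟨hz, hzN⟩
    obtain ⟨w, hw, hwx⟩ := mem_closure_iff.1 hz _ (isOpen_interior.pathComponentIn z)
      (mem_pathComponentIn_self (hsub hzN))
    exact JoinedIn.trans hwx (JoinedIn.symm hw)

theorem joinedIn_p {i : ℕ} {x : X} (hx : x ∈ E.N (i + 1)) : JoinedIn (E.N i) (E.p i) x := by
  refine JoinedIn.trans ⟨(E.path i).map continuous_subtype_val, fun t => ?_⟩
    (E.joinedIn (E.p (i + 1)).2 hx)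
  exact (E.path i t).2

theorem endConnected (E : BasedEndSequence X) : EndConnected X := by
  intro K hK
  obtain ⟨i, hi⟩ := E.cofinal K hK
  refine ⟨K ∪ closure (E.N (i + 1))ᶜ, hK.union (E.isCompact_closure_compl _), subset_union_left,
    fun x hx y hy => (E.joinedIn ?_ ?_).mono hi.subset_compl_right⟩
  · exact E.compl_closure_compl_subset _ fun h => hx (Or.inr h)
  · exact E.compl_closure_compl_subset _ fun h => hy (Or.inr h)

/-- Topological form of pro-monomorphy. -/
theorem exists_detectsLoops (hE : E.proPi1.ProMonomorphic) :
    ∃ C : Set X, IsCompact C ∧ ∀ D : Set X, IsCompact D → ∃ D', IsCompact D' ∧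
      DetectsLoops C D D' := by
  obtain ⟨m, hm⟩ := hE.exists_ker_le
  refine ⟨closure (E.N m)ᶜ, E.isCompact_closure_compl m, fun D hD => ?_⟩
  obtain ⟨j, hj⟩ := E.cofinal D hD
  obtain ⟨k, hik, hmk, hk⟩ := hm (max m j) (le_max_left _ _)
  -- The index `k + 1` leaves room to join the loop to the base point inside `N k`.
  refine ⟨closure (E.N (k + 1))ᶜ, E.isCompact_closure_compl _, fun γ hγ hnull => ?_⟩
  have hγk : ∀ t, γ t ∈ E.N (k + 1) := fun t => E.compl_closure_compl_subset _ (hγ t)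
  obtain ⟨w, -⟩ := (E.joinedIn_p (hγk 0)).exists_liesIn (E.p k).2 (E.subset k (hγk 0)) subset_rfl
  let δ : Path (⟨γ 0, E.subset k (hγk 0)⟩ : E.N k) ⟨γ 0, E.subset k (hγk 0)⟩ :=
    { toFun := fun t => ⟨γ t, E.subset k (hγk t)⟩
      continuous_toFun := NullIn.continuous hnull |>.subtype_mk _
      source' := rfl
      target' := Subtype.ext (NullIn.apply_one hnull) }
  let d : (⟨⟨γ 0, E.subset k (hγk 0)⟩⟩ : FundamentalGroupoid (E.N k)) ⟶
    ⟨⟨γ 0, E.subset k (hγk 0)⟩⟩ := Path.Homotopic.Quotient.mk δ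
  have key : ∀ {l : ℕ} (hl : l ≤ k), E.proPi1.comp hl (w ≫ d ≫ Groupoid.inv w) = 1 ↔
      (δ.map (continuous_inclusion (E.antitone hl))).Homotopic (Path.refl _) := by
    intro l hl
    exact (E.comp_eq_one_iff hl _).trans
      ((Groupoid.map_conj_eq_id_iff (inclFunctor (E.antitone hl)) w d).trans
        Path.Homotopic.Quotient.eq)
  have h1 := hk _ ((key hmk).2 (NullIn.homotopic_refl hnull (E.compl_closure_compl_subset m)))
  exact NullIn.mono (NullIn.of_homotopic_refl ((key hik).1 h1))
    (E.disjoint_mono (le_max_right _ _) hj).subset_compl_right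

end BasedEndSequence

end EndSequences

/-! ### Pushing paths off compact sets by means of the action. -/

section Pushing

open Set CategoryTheory unitInterval

variable {X : Type u} [TopologicalSpace X]

/-- Morphisms of the fundamental groupoid that lie in a union of open sets decompose into morphisms
lying in the members, with division points in the overlaps. -/
theorem LiesIn.induction_of_cover {ι : Type*} {A W : Set X} {U : ι → Set X}
    (hU : ∀ i, IsOpen (U i)) (hW : ∀ i j, i ≠ j → U i ∩ U j ⊆ W)
    {P : ∀ {x y : FundamentalGroupoid A}, (x ⟶ y) → Prop}
    (hP : ∀ {x y : FundamentalGroupoid A} (i : ι) (f : x ⟶ y), (x.as : X) ∈ W →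
      (y.as : X) ∈ W → LiesIn (U i) f → P f)
    (hcomp : ∀ {x y z : FundamentalGroupoid A} (f : x ⟶ y) (g : y ⟶ z), (y.as : X) ∈ W →
      P f → P g → P (f ≫ g))
    {x y : FundamentalGroupoid A} {f : x ⟶ y} (hx : (x.as : X) ∈ W) (hy : (y.as : X) ∈ W)
    (hf : LiesIn (⋃ i, U i) f) : P f := by
  obtain ⟨γ, hγ, rfl⟩ := hf
  obtain ⟨a⟩ := x
  obtain ⟨b⟩ := y
  change Path a b at γ
  obtain ⟨c, rfl, rfl⟩ := γ
  set γ : Path (c.toFun 0) (c.toFun 1) := ⟨c, rfl, rfl⟩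
  obtain ⟨t, ht0, htm, ⟨N, hN⟩, htU⟩ := exists_monotone_Icc_subset_open_cover_unitInterval
    (c := fun i => (fun s => (γ s : X)) ⁻¹' U i) (fun i => (hU i).preimage (by fun_prop))
    fun s _ => by
      obtain ⟨i, hi⟩ := mem_iUnion.1 (hγ s)
      exact mem_iUnion.2 ⟨i, hi⟩
  have hpiece : ∀ n, ∃ i, LiesIn (A := A) (x := ⟨γ (t n)⟩) (y := ⟨γ (t (n + 1))⟩) (U i)
      (Path.Homotopic.Quotient.mk (γ.subpath (t n) (t (n + 1)))) := by
    intro n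
    obtain ⟨i, hi⟩ := htU n
    refine ⟨i, _, fun s => ?_, rfl⟩
    have h1 : γ.subpath (t n) (t (n + 1)) s ∈ range (γ.subpath (t n) (t (n + 1))) := ⟨s, rfl⟩
    rw [Path.range_subpath_of_le _ _ _ (htm n.le_succ)] at h1
    obtain ⟨r, hr, he⟩ := h1
    rw [← he]
    exact hi hr
  have hmk : ∀ n, (Path.Homotopic.Quotient.mk (γ.subpath (t 0) (t (n + 1))) :
      (⟨γ (t 0)⟩ : FundamentalGroupoid A) ⟶ ⟨γ (t (n + 1))⟩) =
      CategoryStruct.comp (Y := (⟨γ (t n)⟩ : FundamentalGroupoid A))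
        (Path.Homotopic.Quotient.mk (γ.subpath (t 0) (t n)))
        (Path.Homotopic.Quotient.mk (γ.subpath (t n) (t (n + 1)))) := fun n =>
    (Path.Homotopic.Quotient.eq.2 ⟨Path.Homotopy.subpathTransSubpath γ _ _ _⟩).symm
  have hx' : (γ (t 0) : X) ∈ W := by rw [ht0]; exact hx
  -- Invariant: a finished part `f`, then a pending part `g` in a single member. When the next piece
  -- needs another member, the division point is in the overlap and `g` can be closed off.
  have key : ∀ n, ∃ (z : FundamentalGroupoid A) (i : ι)
      (f : (⟨γ (t 0)⟩ : FundamentalGroupoid A) ⟶ z) (g : z ⟶ ⟨γ (t n)⟩),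
      (z.as : X) ∈ W ∧ P f ∧ LiesIn (U i) g ∧
        (Path.Homotopic.Quotient.mk (γ.subpath (t 0) (t n)) :
          (⟨γ (t 0)⟩ : FundamentalGroupoid A) ⟶ ⟨γ (t n)⟩) = f ≫ g := by
    intro n
    induction n with
    | zero =>
      obtain ⟨i, hi⟩ := hpiece 0
      have hid : LiesIn (U i) (𝟙 (⟨γ (t 0)⟩ : FundamentalGroupoid A)) := LiesIn.id hi.source_mem
      refine ⟨_, i, 𝟙 _, 𝟙 _, hx', hP i _ hx' hx' hid, hid, ?_⟩
      rw [Category.comp_id, Path.subpath_self]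
      rfl
    | succ n ih =>
      obtain ⟨z, i, f, g, hz, hf, hg, he⟩ := ih
      obtain ⟨j, hj⟩ := hpiece n
      rw [hmk n, he]
      by_cases hij : i = j
      · subst hij
        exact ⟨z, i, f, _, hz, hf, hg.comp hj, Category.assoc _ _ _⟩
      · have hn := hW i j hij ⟨hg.target_mem, hj.source_mem⟩
        exact ⟨_, j, f ≫ g, _, hn, hcomp _ _ hz hf (hP i _ hz hn hg), hj, rfl⟩
  obtain ⟨z, i, f, g, hz, hf, hg, he⟩ := key N
  have h1 : t N = 1 := hN N le_rfl
  have hy' : (γ (t N) : X) ∈ W := by rw [h1]; exact hy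
  have h2 := he ▸ hcomp _ _ hz hf (hP i _ hz hy' hg)
  rw [h1, ht0] at h2
  rw [Path.subpath_zero_one] at h2
  exact h2

variable [AddAction ℤ X] [ContinuousConstVAdd ℤ X] [ProperlyDiscontinuousVAdd ℤ X]

/-- In the fundamental groupoid of `A`, morphisms lying on one side of the translates of `D` are
determined by their endpoints. -/
def SidesSimplyConnected (A D : Set X) : Prop :=
  ∀ s : ℤ, |s| = 1 → ∀ {x y : FundamentalGroupoid A} {f g : x ⟶ y},
    LiesIn (avoid (side s) D) f → LiesIn (avoid (side s) D) g → f = g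

/-- A morphism on one side of `D` between points in periodic components can be translated away
from `K`. -/
theorem SidesSimplyConnected.liesIn_compl {A D K : Set X} (h : SidesSimplyConnected A D)
    (hDA : Dᶜ ⊆ A) (hK : IsCompact K) (hDK : D ⊆ K) {s : ℤ} (hs : |s| = 1)
    {x y : FundamentalGroupoid A} {f : x ⟶ y} (hf : LiesIn (avoid (side s) D) f)
    (hx : ∃ k : ℤ, 0 < k ∧ JoinedIn (avoid univ K) (x.as : X) (k +ᵥ (x.as : X)))
    (hy : ∃ k : ℤ, 0 < k ∧ JoinedIn (avoid univ K) (y.as : X) (k +ᵥ (y.as : X))) :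
    LiesIn Kᶜ f := by
  obtain ⟨γ, hγ, hγf⟩ := id hf
  obtain ⟨k, hk, hxk⟩ := hx
  obtain ⟨l, hl, hyl⟩ := hy
  obtain ⟨N, hN⟩ := exists_nat_forall_vadd_notMem
    (isCompact_range (continuous_subtype_val.comp γ.continuous)) hK
  -- A common multiple of the two periods, so that both endpoints move by the same translation, far
  -- enough to clear `K`.
  obtain ⟨M, hM⟩ : ∃ M : ℕ, (M : ℤ) = N * k * l := ⟨(N * k * l).toNat, by
    rw [Int.toNat_of_nonneg]; positivity⟩
  have hNM : (N : ℤ) ≤ |s * M| := by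
    rw [abs_mul, hs, one_mul, abs_of_nonneg (by positivity), hM, mul_assoc]
    exact le_mul_of_one_le_right (by positivity) (by nlinarith)
  let S : Set X := avoid (side s) D ∩ Kᶜ
  have hKS : avoid univ K ⊆ S := fun z hz =>
    ⟨avoid_mono (subset_univ _) hDK hz, avoid_subset_compl (mem_univ _) _ hz⟩
  have h1 : JoinedIn S (x.as : X) ((s * M) +ᵥ (x.as : X)) := by
    have := hxk.mul_vadd (s * N * l)
    rw [show s * N * l * k = s * M by rw [hM]; ring] at this
    exact this.mono hKS
  have h2 : JoinedIn S (y.as : X) ((s * M) +ᵥ (y.as : X)) := by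
    have := hyl.mul_vadd (s * N * k)
    rw [show s * N * k * l = s * M by rw [hM]; ring] at this
    exact this.mono hKS
  have h3 : JoinedIn S ((s * M) +ᵥ (x.as : X)) ((s * M) +ᵥ (y.as : X)) :=
    ⟨(γ.map continuous_subtype_val).map (continuous_const_vadd (s * M : ℤ)), fun t =>
      ⟨vadd_mem_avoid_side (mul_nat_mem_side s M) (hγ t), hN _ hNM _ ⟨t, rfl⟩⟩⟩
  -- Any detour in `S` will do: it lies on the same side as `f`, so it is homotopic to `f` in `A`.
  obtain ⟨f', hf'⟩ := (h1.trans (h3.trans h2.symm)).exists_liesIn x.as.2 y.as.2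
    (inter_subset_left.trans ((avoid_subset_compl (zero_mem_side s) D).trans hDA))
  rw [h s hs hf (hf'.mono inter_subset_left)]
  exact hf'.mono inter_subset_right

variable [LocallyCompactSpace X] [T2Space X]

/-- Morphisms outside a fixed compact set can be pushed off `K`, once their endpoints have been
moved far from the translates of a compact set `L`. -/
theorem SidesSimplyConnected.liesIn_compl_of_liesIn_union {A D E K L : Set X}
    (h : SidesSimplyConnected A D) (hDA : Dᶜ ⊆ A) (hE : IsCompact E) (hDE : D ⊆ E)
    (hED : ∀ q ∈ avoid univ E, ∃ q' ∈ avoid univ L, JoinedIn (avoid univ D) q q')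
    (hK : IsCompact K) (hDK : D ⊆ K)
    (hL : ∀ q ∈ avoid univ L, ∃ k : ℤ, 0 < k ∧ JoinedIn (avoid univ K) q (k +ᵥ q))
    {x y x' y' : FundamentalGroupoid A} {f : x ⟶ y} (hx : (x.as : X) ∈ avoid univ E)
    (hy : (y.as : X) ∈ avoid univ E)
    (hf : LiesIn (avoid (side 1) E ∪ avoid (side (-1)) E) f) {u : x ⟶ x'} {v : y ⟶ y'}
    (hu : LiesIn (avoid univ D) u) (hv : LiesIn (avoid univ D) v)
    (hx' : (x'.as : X) ∈ avoid univ L) (hy' : (y'.as : X) ∈ avoid univ L) :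
    LiesIn Kᶜ (Groupoid.inv u ≫ f ≫ v) := by
  have hs : ∀ s : ℤˣ, |(s : ℤ)| = 1 := fun s => by
    rcases Int.units_eq_one_or s with rfl | rfl <;> simp
  revert x' y'
  refine LiesIn.induction_of_cover (ι := ℤˣ) (A := A) (W := avoid univ E)
    (U := fun s => avoid (side s) E) (fun s => isOpen_avoid _ hE) ?_
    (P := fun {x y} f => ∀ {x' y' : FundamentalGroupoid A} {u : x ⟶ x'} {v : y ⟶ y'},
      LiesIn (avoid univ D) u → LiesIn (avoid univ D) v → (x'.as : X) ∈ avoid univ L →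
      (y'.as : X) ∈ avoid univ L → LiesIn Kᶜ (Groupoid.inv u ≫ f ≫ v)) ?_ ?_ hx hy ?_
  · intro s t hst
    rcases Int.units_eq_one_or s with rfl | rfl <;> rcases Int.units_eq_one_or t with rfl | rfl
    · exact (hst rfl).elim
    · exact avoid_side_inter.subset
    · rw [inter_comm]; exact avoid_side_inter.subset
    · exact (hst rfl).elim
  · intro x y s f _ _ hf x' y' u v hu hv hx' hy'
    have hsub : avoid univ D ⊆ avoid (side s) D := avoid_mono (subset_univ _) subset_rfl
    exact h.liesIn_compl hDA hK hDK (hs s)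
      ((hu.inv.mono hsub).comp ((hf.mono (avoid_mono subset_rfl hDE)).comp (hv.mono hsub)))
      (hL _ hx') (hL _ hy')
  · intro x y z f g hy hf hg x' z' u w hu hw hx' hz'
    -- Inserting a detour to a deep point `q` and back at the division point lets the two pieces be
    -- pushed separately.
    obtain ⟨q, hq, hyq⟩ := hED _ hy
    have hDA' : avoid univ D ⊆ A := (avoid_subset_compl (mem_univ _) D).trans hDA
    obtain ⟨v, hv⟩ := hyq.exists_liesIn y.as.2 (hDA' hyq.target_mem) hDA'
    have := (hf hu hv hx' hq).comp (hg hv hw hq hz')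
    simpa using this
  · refine hf.mono (union_subset ?_ ?_)
    · exact subset_iUnion (fun s : ℤˣ => avoid (side s) E) 1
    · exact subset_iUnion (fun s : ℤˣ => avoid (side s) E) (-1)

end Pushing

/-! ### The Mittag-Leffler property and the conclusion. -/

section Main

open Set CategoryTheory

theorem CategoryTheory.Groupoid.conj_transport_eq {C : Type*} [Groupoid C] {p q q' p' : C}
    (w : p ⟶ q) (u : q ⟶ q') (v : q' ⟶ p') (r : p ⟶ p') (a : p ⟶ p) :
    r ≫ (Groupoid.inv v ≫ Groupoid.inv (Groupoid.inv u ≫ (Groupoid.inv w ≫ r ≫ Groupoid.inv v) ≫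
      𝟙 q') ≫ (Groupoid.inv u ≫ (Groupoid.inv w ≫ a ≫ w) ≫ u) ≫
      (Groupoid.inv u ≫ (Groupoid.inv w ≫ r ≫ Groupoid.inv v) ≫ 𝟙 q') ≫ v) ≫
      Groupoid.inv r = a := by
  simp

theorem CategoryTheory.Groupoid.map_groupoid_inv {C D : Type*} [Groupoid C] [Groupoid D]
    (F : C ⥤ D) {x y : C} (f : x ⟶ y) : F.map (Groupoid.inv f) = Groupoid.inv (F.map f) := by
  simp

variable {X : Type u} [TopologicalSpace X]

theorem DetectsLoops.mono {C C' D D' : Set X} (h : DetectsLoops C D D') (hC : C ⊆ C') :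
    DetectsLoops C' D D' := fun γ hγ hn => h γ hγ (hn.mono (compl_subset_compl.2 hC))

variable [AddAction ℤ X] [ContinuousConstVAdd ℤ X] [ProperlyDiscontinuousVAdd ℤ X]

/-- Applying detection to the union of the translates of `C` by 1 and by -1 serves both sides at
once. -/
theorem exists_sidesSimplyConnected [SimplyConnectedSpace X] {C : Set X} (hC : IsCompact C)
    (hdet : ∀ D : Set X, IsCompact D → ∃ D', IsCompact D' ∧ DetectsLoops C D D')
    {A : Set X} (hA : Cᶜ ⊆ A) :
    ∃ D : Set X, IsCompact D ∧ C ⊆ D ∧ SidesSimplyConnected A D := by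
  obtain ⟨D', hD', hdet⟩ := hdet (((fun x : X => (1 : ℤ) +ᵥ x) '' C) ∪
    ((fun x : X => (-1 : ℤ) +ᵥ x) '' C))
    ((hC.image (continuous_const_vadd _)).union (hC.image (continuous_const_vadd _)))
  refine ⟨D' ∪ C, hD'.union hC, subset_union_right, fun s hs x y f g hf hg => ?_⟩
  have hsub : avoid (side s) (D' ∪ C) ⊆ avoid (side s) D' := avoid_mono subset_rfl subset_union_left
  refine hdet.eq_of_liesIn hC hs (fun x hx => ?_) hA (hf.mono hsub) (hg.mono hsub)
  rcases (abs_eq one_pos.le).1 hs with rfl | rfl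
  · exact Or.inl ⟨x, hx, rfl⟩
  · exact Or.inr ⟨x, hx, rfl⟩

variable [LocallyCompactSpace X] [T2Space X] [LocallyPathConnectedSpace X]
  [SimplyConnectedSpace X]

/-- The Mittag-Leffler property of the fundamental pro-group. -/
theorem BasedEndSequence.exists_range_le (E : BasedEndSequence X) {C : Set X} (hC : IsCompact C)
    (hdet : ∀ D : Set X, IsCompact D → ∃ D', IsCompact D' ∧ DetectsLoops C D D') (m : ℕ) :
    ∃ i, ∃ hmi : m ≤ i, ∀ k (hik : i ≤ k),
      (E.proPi1.comp hmi).range ≤ (E.proPi1.comp (hmi.trans hik)).range := by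
  obtain ⟨D, hD, hCD, hsides⟩ := exists_sidesSimplyConnected
    (hC.union (E.isCompact_closure_compl m)) (A := E.N m)
    (fun D hD => (hdet D hD).imp fun D' h => ⟨h.1, h.2.mono subset_union_left⟩)
    ((compl_subset_compl.2 subset_union_right).trans (E.compl_closure_compl_subset m))
  have hDA : Dᶜ ⊆ E.N m := (compl_subset_compl.2 (subset_union_right.trans hCD)).trans
    (E.compl_closure_compl_subset m)
  obtain ⟨F, hF, hDF, hub⟩ := exists_isCompact_forall_component_unbounded hD
  obtain ⟨M, hM, hMF⟩ := exists_isCompact_compl_subset_avoid_union hF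
  obtain ⟨j, hj⟩ := E.cofinal M hM
  let l := max m j
  have hml : m ≤ l := le_max_left _ _
  have hlF : E.N l ⊆ avoid (side 1) F ∪ avoid (side (-1)) F :=
    (E.disjoint_mono (le_max_right m j) hj).subset_compl_right.trans hMF
  have hmi : m ≤ l + 1 := hml.trans l.le_succ
  refine ⟨l + 1, hmi, fun k hik => ?_⟩
  rintro _ ⟨a, rfl⟩
  have hK : IsCompact (D ∪ closure (E.N (k + 1))ᶜ) := hD.union (E.isCompact_closure_compl _)
  set K := D ∪ closure (E.N (k + 1))ᶜ
  have hKk : Kᶜ ⊆ E.N (k + 1) :=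
    (compl_subset_compl.2 subset_union_right).trans (E.compl_closure_compl_subset _)
  obtain ⟨L, hL, hKL, hper⟩ := E.endConnected.exists_isCompact_forall_joinedIn_vadd hK
  obtain ⟨q, hq⟩ := E.endConnected.nonempty_avoid_univ
    (hF.union (E.isCompact_closure_compl (l + 1)))
  have hqF : q ∈ avoid univ F := avoid_mono subset_rfl subset_union_left hq
  have hqi : q ∈ E.N (l + 1) := E.compl_closure_compl_subset _
    (avoid_subset_compl (mem_univ _) _ (avoid_mono subset_rfl subset_union_right hq))
  -- Depth `L` gives a periodic component; depth `F` allows `q'` to be an endpoint of the path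
  -- pushed in `h2`.
  obtain ⟨q', hq', hqq'⟩ := hub q hqF (L ∪ F) (hL.union hF)
  have hq'L : q' ∈ avoid univ L := avoid_mono subset_rfl subset_union_left hq'
  have hq'F : q' ∈ avoid univ F := avoid_mono subset_rfl subset_union_right hq'
  have hq'k : q' ∈ E.N (k + 1) :=
    hKk fun h => avoid_subset_compl (mem_univ _) _ hq'L (hKL h)
  have hmk : m ≤ k := hmi.trans hik
  have hpi := E.antitone hmi (E.p (l + 1)).2
  have hpk := E.antitone hmk (E.p k).2
  have hqm := E.antitone hmi hqi
  have hq'm := E.antitone (hmk.trans k.le_succ) hq'k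
  obtain ⟨w, hw⟩ := (E.joinedIn (E.p (l + 1)).2 hqi).exists_liesIn hpi hqm (E.antitone hml)
  obtain ⟨v, hv⟩ := (E.joinedIn_p hq'k).symm.exists_liesIn hq'm hpk (E.antitone hmk)
  obtain ⟨u, hu⟩ := hqq'.exists_liesIn hqm hq'm
    ((avoid_subset_compl (mem_univ _) D).trans hDA)
  obtain ⟨ρ, hρ⟩ := E.exists_comp_apply hik
  obtain ⟨τ, hτ⟩ := E.exists_comp_apply hmi
  let Fi := inclFunctor (E.antitone hmi)
  let a' : Fi.obj ⟨E.p (l + 1)⟩ ⟶ Fi.obj ⟨E.p (l + 1)⟩ := Fi.map a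
  let r₀ := Fi.map ρ
  let r : (⟨⟨E.p (l + 1), hpi⟩⟩ : FundamentalGroupoid (E.N m)) ⟶ ⟨⟨E.p k, hpk⟩⟩ := r₀
  have ha' : LiesIn (E.N l) a' := (LiesIn.inclFunctor_map _ _).mono (E.subset l)
  have hr : LiesIn (E.N l) r₀ := (LiesIn.inclFunctor_map _ _).mono (E.subset l)
  have push := fun {x y x' y' : FundamentalGroupoid (E.N m)} {f : x ⟶ y} hx hy hf
    {u : x ⟶ x'} {v : y ⟶ y'} => hsides.liesIn_compl_of_liesIn_union hDA hF hDF
      (fun q hq => hub q hq L hL) hK subset_union_left hper (f := f) hx hy hf (u := u) (v := v)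
  have h1 := push hqF hqF ((hw.inv.comp (ha'.comp hw)).mono hlF) hu hu hq'L hq'L
  -- The ray segment is pushed as well as the loop: the bonds conjugate along the given ray, so the
  -- pushed loop must be carried to `p k` compatibly with it.
  have h2 := push hqF hq'F ((hw.inv.comp (hr.comp
    (hv.inv.mono (E.antitone (l.le_succ.trans hik))))).mono hlF) hu
    (LiesIn.id hqq'.target_mem) hq'L hq'L
  have hKk' : Kᶜ ⊆ E.N k := hKk.trans (E.subset k)
  -- The pushed loop, conjugated by the pushed ray and by `v`, lies in `N k`; conjugating it further
  -- by `r` cancels everything but `a'`.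
  obtain ⟨b, hb⟩ := LiesIn.exists_lift (E.antitone hmk) (a := E.p k) (b := E.p k)
    (hv.inv.comp ((h2.inv.mono hKk').comp ((h1.mono hKk').comp ((h2.mono hKk').comp hv))))
  refine ⟨b, ?_⟩
  refine (InverseSequence.comp_comp_apply E.proPi1 hmi hik b).symm.trans ?_
  refine (hτ _).trans ((congrArg (fun f => τ ≫ f ≫ Groupoid.inv τ) ?_).trans (hτ a).symm)
  refine (congrArg Fi.map (hρ b)).trans ?_
  refine Eq.trans ?_ (Groupoid.conj_transport_eq w u v r a')
  refine (Fi.map_comp _ _).trans (congrArg (fun f => r ≫ f) ?_)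
  refine (Fi.map_comp _ _).trans (congrArg₂ (fun f g => f ≫ g) ?_ (Groupoid.map_groupoid_inv Fi ρ))
  exact (inclFunctor_map_map (E.antitone hik) (E.antitone hmi) (x := ⟨E.p k⟩) (y := ⟨E.p k⟩)
    b).trans hb

end Main

theorem mainTheorem2 (X : Type u) [MetricSpace X] [TopologicalSpace.SeparableSpace X]
    [LocallyCompactSpace X] [LocallyPathConnectedSpace X] [SimplyConnectedSpace X]
    (hend : OneEnded X) (hmono : HasProMonomorphicPi1AtInfinity X)
    [AddAction ℤ X] (hact : ActsByCoveringTransformations X ℤ) :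
    HasStablePi1AtInfinity X := by
  have : ContinuousConstVAdd ℤ X := ⟨hact.continuous_vadd⟩
  have : ProperlyDiscontinuousVAdd ℤ X := ⟨fun {K L} hK hL =>
    (hact.properlyDiscontinuous _ (hK.union hL)).subset fun n hn =>
      (Set.Nonempty.mono (Set.inter_subset_inter (Set.image_mono Set.subset_union_left)
        Set.subset_union_right) hn)⟩
  obtain ⟨E₀, hE₀⟩ := hmono
  obtain ⟨C, hC, hdet⟩ := E₀.exists_detectsLoops hE₀
  refine ⟨⟨E₀⟩, fun E => ?_⟩
  obtain ⟨m, hm⟩ := E.exists_ker_le hC hdet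
  exact InverseSequence.stable_of_ker_le_of_range_le m hm (E.exists_range_le hC hdet m)
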